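/- Consider the first-order language with equality whose symbols are the numerals $m$ and the decimal literals $m/10^{k+1}$ (for $m,k\in\mathbb N$) as constants, the function symbols unary $-$, binary $-$, $+$, $\cdot$, $/$, and the predicate symbols $\le,<,\ge,>$ (the signature of the SMT-LIB theory NRA of nonlinear real arithmetic). A model of NRA is the set $\mathbb R$ with the standard interpretation of all symbols except division, which is interpreted by any function $d:\mathbb R\times\mathbb R\to\mathbb R$ such that $x=d(x,y)\cdot y$ for all $x,y\in\mathbb R$ with $y\neq 0$; thus the values $d(x,0)$ are arbitrary. Formulas may contain quantifiers over the reals. Then real arithmetic with uninterpreted division by zero is undecidable: 1. There is no algorithm which decides, given a formula $\varphi$ (possibly with free variables), whether $\varphi$ is satisfiable, that is, whether there are a model of NRA and an assignment of real numbers to the free variables of $\varphi$ under which $\varphi$ is true. 2. There is no algorithm which decides, given a sentence $\sigma$, whether $\sigma$ belongs to the theory NRA, that is, whether $\sigma$ is true in every model of NRA. Here an algorithm is a total computable function applied to the Gödel number of the input formula. -/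

import Mathlib

namespace NRA

/-- Function symbols of the SMT-LIB signature of real arithmetic, indexed by arity.
`num m` is the numeral `m`; `dec m k` is the decimal literal whose digits are those of `m`, with
`k + 1` of them after the decimal point, i.e. the number `m / 10 ^ (k + 1)`. -/
inductive Func : ℕ → Type
  | num (m : ℕ) : Func 0
  | dec (m k : ℕ) : Func 0
  | neg : Func 1
  | sub : Func 2
  | add : Func 2
  | mul : Func 2
  | div : Func 2

/-- Predicate symbols (equality is a logical symbol). -/
inductive Rel : ℕ → Type
  | le : Rel 2
  | lt : Rel 2
  | ge : Rel 2
  | gt : Rel 2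

/-- The first-order language of NRA. -/
def lang : FirstOrder.Language.{0, 0} := ⟨Func, Rel⟩

/-- The admissible interpretations of division: the values `d x 0` are arbitrary. -/
def IsDivision (d : ℝ → ℝ → ℝ) : Prop :=
  ∀ x y : ℝ, y ≠ 0 → x = d x y * y

/-- Interpretation of the function symbols, with `div` interpreted by `d`. -/
noncomputable def Func.eval (d : ℝ → ℝ → ℝ) : {n : ℕ} → Func n → (Fin n → ℝ) → ℝ
  | _, .num m, _ => (m : ℝ)
  | _, .dec m k, _ => (m : ℝ) / 10 ^ (k + 1)
  | _, .neg, x => - x 0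
  | _, .sub, x => x 0 - x 1
  | _, .add, x => x 0 + x 1
  | _, .mul, x => x 0 * x 1
  | _, .div, x => d (x 0) (x 1)

/-- Interpretation of the predicate symbols. -/
def Rel.holds : {n : ℕ} → Rel n → (Fin n → ℝ) → Prop
  | _, .le, x => x 0 ≤ x 1
  | _, .lt, x => x 0 < x 1
  | _, .ge, x => x 0 ≥ x 1
  | _, .gt, x => x 0 > x 1

/-- The real numbers with the standard interpretation of every symbol except `div`, which is
interpreted by `d`. -/
@[reducible] noncomputable def realStructure (d : ℝ → ℝ → ℝ) : lang.Structure ℝ where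
  funMap := fun f x => Func.eval d f x
  RelMap := fun r x => Rel.holds r x

/-- Satisfiability in NRA of a formula whose free variables (indexed by `ℕ`) play the role of the
free constants of an SMT problem. -/
def Satisfiable (φ : lang.Formula ℕ) : Prop :=
  ∃ d : ℝ → ℝ → ℝ, IsDivision d ∧ ∃ v : ℕ → ℝ,
    @FirstOrder.Language.Formula.Realize lang ℝ (realStructure d) ℕ φ v

/-- The theory NRA: the sentences that hold for every admissible interpretation of division. -/
def theory : lang.Theory :=
  {σ | ∀ d : ℝ → ℝ → ℝ, IsDivision d → @FirstOrder.Language.Sentence.Realize lang ℝ (realStructure d) σ}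

/-! ### Gödel numbering -/

/-- Code of a function symbol. -/
def Func.code : {n : ℕ} → Func n → ℕ
  | _, .num m => Nat.pair 0 m
  | _, .dec m k => Nat.pair 1 (Nat.pair m k)
  | _, .neg => Nat.pair 2 0
  | _, .sub => Nat.pair 3 0
  | _, .add => Nat.pair 4 0
  | _, .mul => Nat.pair 5 0
  | _, .div => Nat.pair 6 0

/-- Code of a predicate symbol. -/
def Rel.code : {n : ℕ} → Rel n → ℕ
  | _, .le => 0
  | _, .lt => 1
  | _, .ge => 2
  | _, .gt => 3

/-- Gödel number of a term; finite sequences of numbers are coded by the standard encoding of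
`List ℕ`. -/
def termCode {β : Type} [Encodable β] : lang.Term β → ℕ
  | .var b => Nat.pair 0 (Encodable.encode b)
  | .func f ts =>
      Nat.pair 1 (Nat.pair (Func.code f) (Encodable.encode (List.ofFn fun i => termCode (ts i))))

/-- Gödel number of a formula. -/
def formulaCode {α : Type} [Encodable α] : {n : ℕ} → lang.BoundedFormula α n → ℕ
  | _, .falsum => Nat.pair 0 0
  | _, .equal t₁ t₂ => Nat.pair 1 (Nat.pair (termCode t₁) (termCode t₂))
  | _, .rel R ts =>
      Nat.pair 2 (Nat.pair (Rel.code R) (Encodable.encode (List.ofFn fun i => termCode (ts i))))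
  | _, .imp φ ψ => Nat.pair 3 (Nat.pair (formulaCode φ) (formulaCode ψ))
  | _, .all φ => Nat.pair 4 (formulaCode φ)

theorem Func.code_inj : ∀ {m n : ℕ} (f : Func m) (g : Func n), f.code = g.code →
    m = n ∧ HEq f g := by
  intro m n f g h
  cases f <;> cases g <;> simp_all [Func.code, Nat.pair_eq_pair]

theorem Rel.code_inj : ∀ {m n : ℕ} (f : Rel m) (g : Rel n), f.code = g.code →
    m = n ∧ HEq f g := by
  intro m n f g h
  cases f <;> cases g <;> simp_all [Rel.code]

theorem termCode_injective {β : Type} [Encodable β] :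
    Function.Injective (termCode : lang.Term β → ℕ) := by
  intro t
  induction t with
  | var b =>
    intro s h
    cases s with
    | var c => simpa [termCode, Nat.pair_eq_pair] using h
    | func g us => simp [termCode, Nat.pair_eq_pair] at h
  | func f ts ih =>
    intro s h
    cases s with
    | var c => simp [termCode, Nat.pair_eq_pair] at h
    | func g us =>
      simp only [termCode, Nat.pair_eq_pair, true_and, Encodable.encode_inj] at h
      obtain ⟨rfl, hf⟩ := Func.code_inj f g h.1
      obtain rfl := eq_of_heq hf
      have := List.ofFn_injective h.2
      congr 1
      funext i
      exact ih i (congrFun this i)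

/-- Distinct formulas have distinct Gödel numbers. -/
theorem formulaCode_injective {α : Type} [Encodable α] {n : ℕ} :
    Function.Injective (formulaCode : lang.BoundedFormula α n → ℕ) := by
  intro φ
  induction φ with
  | falsum => intro ψ h; cases ψ <;> simp_all [formulaCode, Nat.pair_eq_pair]
  | equal t₁ t₂ =>
    intro ψ h
    cases ψ <;> simp [formulaCode, Nat.pair_eq_pair] at h
    rw [termCode_injective h.1, termCode_injective h.2]
  | rel R ts =>
    intro ψ h
    cases ψ with
    | rel S us =>
      simp only [formulaCode, Nat.pair_eq_pair, true_and, Encodable.encode_inj] at h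
      obtain ⟨rfl, hf⟩ := Rel.code_inj R S h.1
      obtain rfl := eq_of_heq hf
      have := List.ofFn_injective h.2
      congr 1
      funext i
      exact termCode_injective (congrFun this i)
    | _ => simp [formulaCode, Nat.pair_eq_pair] at h
  | imp φ₁ φ₂ ih₁ ih₂ =>
    intro ψ h
    cases ψ <;> simp [formulaCode, Nat.pair_eq_pair] at h
    rw [ih₁ h.1, ih₂ h.2]
  | all φ ih =>
    intro ψ h
    cases ψ <;> simp [formulaCode, Nat.pair_eq_pair] at h
    rw [ih h]

/-- A property of formulas with free variables in `α` is decidable if some total computable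
function decides it from Gödel numbers (its values at other numbers do not matter). -/
def AlgorithmicallyDecidable {α : Type} [Encodable α] (P : lang.Formula α → Prop) : Prop :=
  ∃ f : ℕ → Bool, Computable f ∧ ∀ φ : lang.Formula α, f (formulaCode φ) = true ↔ P φ

end NRA

namespace NRA

open FirstOrder FirstOrder.Language

/-! The axiom for division leaves `x ↦ x / 0` a free unary function on ℝ. One sentence forces it to
be the indicator of the complement of ℕ (`realize_natDivisionSentence_iff`), so ℕ becomes definable
in ℝ. Quantifiers relativised to ℕ, together with Gödel's beta function, then define the graph of
every partial recursive function (`Arithmetical.of_partrec`).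

Conjoining the sentence with a definition of halting yields a formula that, at the numeral `n`, has
a model iff program `n` halts, and whose negation is valid iff it does not. A decision procedure for
satisfiability or for the theory would thus solve the halting problem. -/

/-- The interpretation of division for which `x / 0` is the indicator of the complement of `ℕ`. -/
noncomputable def natDivision (x y : ℝ) : ℝ :=
  open Classical in if y = 0 then (if ∃ n : ℕ, (n : ℝ) = x then 0 else 1) else x / y

theorem isDivision_natDivision : IsDivision natDivision := by
  intro x y hy
  simp [natDivision, hy]

theorem natDivision_zero_eq_zero_iff (x : ℝ) : natDivision x 0 = 0 ↔ ∃ n : ℕ, (n : ℝ) = x := by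
  simp [natDivision]

/-! ### Building terms and evaluating them. -/

section Terms

variable {β : Type}

/-- The term `m` for a numeral. -/
def numTerm (m : ℕ) : lang.Term β := Constants.term (Func.num m : lang.Constants)

/-- The term `s + t`. -/
def addTerm (s t : lang.Term β) : lang.Term β := Functions.apply₂ (Func.add : lang.Functions 2) s t

/-- The term `s - t`. -/
def subTerm (s t : lang.Term β) : lang.Term β := Functions.apply₂ (Func.sub : lang.Functions 2) s t

/-- The term `s * t`. -/
def mulTerm (s t : lang.Term β) : lang.Term β := Functions.apply₂ (Func.mul : lang.Functions 2) s t

/-- The term `t / 0`. -/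
def divZeroTerm (t : lang.Term β) : lang.Term β :=
  Functions.apply₂ (Func.div : lang.Functions 2) t (numTerm 0)

variable (d : ℝ → ℝ → ℝ) (s t : lang.Term β) (v : β → ℝ)

theorem realize_numTerm (m : ℕ) :
    @Term.realize lang ℝ (realStructure d) β v (numTerm m) = m := rfl

theorem realize_addTerm : @Term.realize lang ℝ (realStructure d) β v (addTerm s t) =
    @Term.realize lang ℝ (realStructure d) β v s +
      @Term.realize lang ℝ (realStructure d) β v t := rfl

theorem realize_subTerm : @Term.realize lang ℝ (realStructure d) β v (subTerm s t) =
    @Term.realize lang ℝ (realStructure d) β v s -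
      @Term.realize lang ℝ (realStructure d) β v t := rfl

theorem realize_mulTerm : @Term.realize lang ℝ (realStructure d) β v (mulTerm s t) =
    @Term.realize lang ℝ (realStructure d) β v s *
      @Term.realize lang ℝ (realStructure d) β v t := rfl

theorem realize_divZeroTerm : @Term.realize lang ℝ (realStructure d) β v (divZeroTerm t) =
    d (@Term.realize lang ℝ (realStructure d) β v t) 0 := by
  -- The numeral denotes the cast `((0 : ℕ) : ℝ)`, which is not definitionally the real `0`.
  have : d (@Term.realize lang ℝ (realStructure d) β v t) 0 =
    d (@Term.realize lang ℝ (realStructure d) β v t) ((0 : ℕ) : ℝ) := by simp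
  rw [this]; rfl

end Terms

/-! ### Pinning down division by zero. -/

section NatDivision

/-- The formula `s ≤ t`. -/
def leFormula {α : Type} {n : ℕ} (s t : lang.Term (α ⊕ Fin n)) : lang.BoundedFormula α n :=
  Relations.boundedFormula₂ (Rel.le : lang.Relations 2) s t

theorem realize_leFormula {α : Type} {n : ℕ} (d : ℝ → ℝ → ℝ) (s t : lang.Term (α ⊕ Fin n))
    (v : α → ℝ) (xs : Fin n → ℝ) :
    @BoundedFormula.Realize lang ℝ (realStructure d) α n (leFormula s t) v xs ↔
      @Term.realize lang ℝ (realStructure d) _ (Sum.elim v xs) s ≤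
        @Term.realize lang ℝ (realStructure d) _ (Sum.elim v xs) t := Iff.rfl

/-- The sentence saying that `x / 0 ∈ {0, 1}` for all `x`, and that `{x | x / 0 = 0}` contains `0`,
is closed under successor, and has only `0` and numbers `x ≥ 1` with `x - 1` in the set
as elements. -/
def natDivisionSentence (α : Type) : lang.Formula α :=
  let x : lang.Term (α ⊕ Fin 1) := Term.var (Sum.inr 0)
  let N : lang.Term (α ⊕ Fin 1) → lang.BoundedFormula α 1 :=
    fun t => (divZeroTerm t).bdEqual (numTerm 0)
  BoundedFormula.all
    ((N x ⊔ (divZeroTerm x).bdEqual (numTerm 1)) ⊓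
      (N (numTerm 0) ⊓ ((N x).imp (N (addTerm x (numTerm 1))) ⊓
        (N x).imp (x.bdEqual (numTerm 0) ⊔
          (leFormula (numTerm 1) x ⊓
            N (subTerm x (numTerm 1)))))))

theorem realize_natDivisionSentence {α : Type} (d : ℝ → ℝ → ℝ) (v : α → ℝ) :
    @Formula.Realize lang ℝ (realStructure d) α (natDivisionSentence α) v ↔
      ∀ x : ℝ, (d x 0 = 0 ∨ d x 0 = 1) ∧ d 0 0 = 0 ∧ (d x 0 = 0 → d (x + 1) 0 = 0) ∧
        (d x 0 = 0 → x = 0 ∨ 1 ≤ x ∧ d (x - 1) 0 = 0) := by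
  let := realStructure d
  simp only [natDivisionSentence, Formula.Realize, BoundedFormula.realize_all, BoundedFormula.realize_inf,
    BoundedFormula.realize_sup, BoundedFormula.realize_imp, BoundedFormula.realize_bdEqual,
    realize_leFormula, realize_divZeroTerm, realize_numTerm, realize_addTerm,
    realize_subTerm, Term.realize_var, Sum.elim_inr, Nat.cast_zero, Nat.cast_one]
  rfl

/-- Off zero the division axiom determines `d`. At zero, closure under successor puts ℕ in the zero
set, and descent by 1 shows that nothing else is in it. The two-valuedness clause fixes the
remaining values, giving an equality of functions. -/
theorem realize_natDivisionSentence_iff {α : Type} {d : ℝ → ℝ → ℝ} (hd : IsDivision d) (v : α → ℝ) :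
    @Formula.Realize lang ℝ (realStructure d) α (natDivisionSentence α) v ↔ d = natDivision := by
  rw [realize_natDivisionSentence]
  constructor
  · intro h
    have hnat : ∀ n : ℕ, d n 0 = 0 := by
      intro n
      induction n with
      | zero => simpa using (h 0).2.1
      | succ n ih => simpa using (h n).2.2.1 ih
    -- Descent made into induction on an upper bound; the Archimedean property supplies the bound
    -- later.
    have hbound : ∀ (k : ℕ) (x : ℝ), x < k → d x 0 = 0 → ∃ n : ℕ, (n : ℝ) = x := by
      intro k
      induction k with
      | zero =>
        intro x hx h0
        rcases (h x).2.2.2 h0 with h1 | h1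
        · exact ⟨0, by simp [h1]⟩
        · push_cast at hx
          linarith
      | succ k ih =>
        intro x hx h0
        rcases (h x).2.2.2 h0 with h1 | ⟨_, h2⟩
        · exact ⟨0, by simp [h1]⟩
        · push_cast at hx
          obtain ⟨n, hn⟩ := ih (x - 1) (by linarith) h2
          exact ⟨n + 1, by push_cast; linarith⟩
    funext x y
    by_cases hy : y = 0
    · subst hy
      by_cases hx : ∃ n : ℕ, (n : ℝ) = x
      · rw [(natDivision_zero_eq_zero_iff x).2 hx]
        obtain ⟨n, rfl⟩ := hx
        exact hnat n
      · have h1 : d x 0 ≠ 0 := fun h0 => by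
          obtain ⟨k, hk⟩ := exists_nat_gt x
          exact hx (hbound k x hk h0)
        simp [natDivision, hx, (h x).1.resolve_left h1]
    · have := hd x y hy
      simp only [natDivision, hy, if_false]
      rw [eq_div_iff hy, ← this]
  · rintro rfl x
    simp only [natDivision_zero_eq_zero_iff]
    refine ⟨?_, ⟨0, by simp⟩, ?_, ?_⟩
    · by_cases hx : ∃ n : ℕ, (n : ℝ) = x
      · exact Or.inl hx
      · right
        simp [natDivision, hx]
    · rintro ⟨n, rfl⟩
      exact ⟨n + 1, by simp⟩
    · rintro ⟨n, rfl⟩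
      cases n with
      | zero => left; simp
      | succ n => exact Or.inr ⟨by simp, n, by simp⟩

end NatDivision

/-! ### Relations on ℕ definable over ℝ with `natDivision`. -/

section Arithmetical

/-- Functions of natural numbers given by a term over the real numbers. -/
def TermDefinable {α : Type} (f : (α → ℕ) → ℕ) : Prop :=
  ∃ t : lang.Term α, ∀ v : α → ℕ,
    @Term.realize lang ℝ (realStructure natDivision) α (fun a => (v a : ℝ)) t = f v

/-- Relations of natural numbers definable in the real numbers with `natDivision`. -/
def Arithmetical {α : Type} (P : (α → ℕ) → Prop) : Prop :=
  ∃ φ : lang.Formula α, ∀ v : α → ℕ,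
    @Formula.Realize lang ℝ (realStructure natDivision) α φ (fun a => (v a : ℝ)) ↔ P v

variable {α : Type} {f g h : (α → ℕ) → ℕ} {P Q : (α → ℕ) → Prop}

namespace TermDefinable

theorem var (a : α) : TermDefinable fun v => v a := ⟨Term.var a, fun _ => rfl⟩

theorem const (m : ℕ) : TermDefinable fun _ : α → ℕ => m := ⟨numTerm m, fun _ => rfl⟩

theorem add (hf : TermDefinable f) (hg : TermDefinable g) :
    TermDefinable fun v => f v + g v := by
  obtain ⟨s, hs⟩ := hf
  obtain ⟨t, ht⟩ := hg
  exact ⟨addTerm s t, fun v => by rw [realize_addTerm, hs, ht, Nat.cast_add]⟩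

theorem mul (hf : TermDefinable f) (hg : TermDefinable g) :
    TermDefinable fun v => f v * g v := by
  obtain ⟨s, hs⟩ := hf
  obtain ⟨t, ht⟩ := hg
  exact ⟨mulTerm s t, fun v => by rw [realize_mulTerm, hs, ht, Nat.cast_mul]⟩

theorem weaken (hf : TermDefinable f) :
    TermDefinable fun w : α ⊕ Unit → ℕ => f fun a => w (Sum.inl a) := by
  obtain ⟨t, ht⟩ := hf
  refine ⟨t.relabel Sum.inl, fun w => ?_⟩
  rw [← ht, @Term.realize_relabel]
  rfl

theorem last : TermDefinable fun w : α ⊕ Unit → ℕ => w (Sum.inr ()) := var _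

end TermDefinable

namespace Arithmetical

theorem eq (hf : TermDefinable f) (hg : TermDefinable g) : Arithmetical fun v => f v = g v := by
  obtain ⟨s, hs⟩ := hf
  obtain ⟨t, ht⟩ := hg
  refine ⟨s.equal t, fun v => ?_⟩
  rw [@Formula.realize_equal, hs, ht, Nat.cast_inj]

theorem false : Arithmetical fun _ : α → ℕ => False := ⟨⊥, fun _ => Iff.rfl⟩

theorem imp (hP : Arithmetical P) (hQ : Arithmetical Q) : Arithmetical fun v => P v → Q v := by
  obtain ⟨φ, hφ⟩ := hP
  obtain ⟨ψ, hψ⟩ := hQ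
  refine ⟨φ.imp ψ, fun v => ?_⟩
  rw [@Formula.realize_imp, hφ, hψ]

theorem of_iff (hP : Arithmetical P) (H : ∀ v, Q v ↔ P v) : Arithmetical Q := by
  obtain ⟨φ, hφ⟩ := hP
  exact ⟨φ, fun v => (hφ v).trans (H v).symm⟩

theorem not (hP : Arithmetical P) : Arithmetical fun v => ¬P v := hP.imp false

theorem or (hP : Arithmetical P) (hQ : Arithmetical Q) : Arithmetical fun v => P v ∨ Q v :=
  (hP.not.imp hQ).of_iff fun v => by tauto

theorem and (hP : Arithmetical P) (hQ : Arithmetical Q) : Arithmetical fun v => P v ∧ Q v :=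
  (hP.imp hQ.not).not.of_iff fun v => by tauto

/-- The real quantifier is relativised to ℕ by the conjunct `x / 0 = 0`. -/
theorem ex {R : (α → ℕ) → ℕ → Prop}
    (hR : Arithmetical fun w : α ⊕ Unit → ℕ => R (fun a => w (Sum.inl a)) (w (Sum.inr ()))) :
    Arithmetical fun v => ∃ n, R v n := by
  let := realStructure natDivision
  obtain ⟨φ, hφ⟩ := hR
  refine ⟨Formula.iExs Unit
    ((Term.equal (divZeroTerm (Term.var (Sum.inr ()))) (numTerm 0)) ⊓ φ), fun v => ?_⟩
  rw [Formula.realize_iExs]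
  simp only [Formula.realize_inf, Formula.realize_equal, realize_divZeroTerm, realize_numTerm,
    Term.realize_var, Sum.elim_inr, Nat.cast_zero, natDivision_zero_eq_zero_iff]
  have key : ∀ n : ℕ, φ.Realize (Sum.elim (fun a => (v a : ℝ)) fun _ => (n : ℝ)) ↔ R v n := by
    intro n
    refine Iff.trans ?_ (hφ (Sum.elim v fun _ => n))
    have : (fun a => ((Sum.elim v (fun _ : Unit => n) a : ℕ) : ℝ)) =
        Sum.elim (fun a => (v a : ℝ)) fun _ => (n : ℝ) := by
      funext a
      cases a <;> rfl
    rw [this]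
  constructor
  · rintro ⟨i, ⟨n, hn⟩, hi⟩
    refine ⟨n, (key n).1 ?_⟩
    rwa [show (fun _ : Unit => (n : ℝ)) = i from funext fun _ => hn]
  · rintro ⟨n, hn⟩
    exact ⟨fun _ => n, ⟨n, rfl⟩, (key n).2 hn⟩

theorem all {R : (α → ℕ) → ℕ → Prop}
    (hR : Arithmetical fun w : α ⊕ Unit → ℕ => R (fun a => w (Sum.inl a)) (w (Sum.inr ()))) :
    Arithmetical fun v => ∀ n, R v n :=
  (ex (R := fun v n => ¬R v n) hR.not).not.of_iff fun v => by simp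

theorem lt (hf : TermDefinable f) (hg : TermDefinable g) : Arithmetical fun v => f v < g v :=
  (ex (R := fun v n => f v + n + 1 = g v)
    (eq ((hf.weaken.add .last).add (.const 1)) hg.weaken)).of_iff fun v => by
      constructor
      · intro h
        exact ⟨g v - f v - 1, by omega⟩
      · rintro ⟨n, hn⟩
        omega

theorem pair (hf : TermDefinable f) (hg : TermDefinable g) (hh : TermDefinable h) :
    Arithmetical fun v => Nat.pair (f v) (g v) = h v :=
  (((lt hf hg).and (eq ((hg.mul hg).add hf) hh)).or
    ((lt hf hg).not.and (eq (((hf.mul hf).add hf).add hg) hh))).of_iff fun v => by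
      by_cases hlt : f v < g v <;> simp [Nat.pair, hlt]

/-- A remainder is characterised by being below the modulus and by the existence of a quotient. -/
theorem beta (hf : TermDefinable f) (hg : TermDefinable g) (hh : TermDefinable h) :
    Arithmetical fun v => Nat.beta (f v) (g v) = h v := by
  refine of_iff (P := fun v => ∃ a b, Nat.pair a b = f v ∧ h v < (g v + 1) * b + 1 ∧
    ∃ q, h v + ((g v + 1) * b + 1) * q = a) ?_ fun v => ?_
  · refine ex (ex (and ?_ (and ?_ (ex ?_))))
    · exact pair (.var _) .last hf.weaken.weaken
    · exact lt hh.weaken.weaken (((hg.weaken.weaken.add (.const 1)).mul .last).add (.const 1))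
    · exact eq (hh.weaken.weaken.weaken.add ((((hg.weaken.weaken.weaken.add (.const 1)).mul
        (.var _)).add (.const 1)).mul .last)) (.var _)
  · constructor
    · intro hb
      refine ⟨_, _, Nat.pair_unpair (f v), ?_, (f v).unpair.1 / ((g v + 1) * (f v).unpair.2 + 1), ?_⟩
      · rw [← hb]
        exact Nat.mod_lt _ (Nat.succ_pos _)
      · rw [← hb]
        exact Nat.mod_add_div _ _
    · rintro ⟨a, b, hab, hlt, q, rfl⟩
      rw [Nat.beta, ← hab, Nat.unpair_pair]
      simp [Nat.add_mul_mod_self_left, Nat.mod_eq_of_lt hlt]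

end Arithmetical

end Arithmetical

/-! ### Graphs of partial recursive functions. -/

/-- A primitive recursion has value `b` iff some finite sequence of intermediate values runs from `f
a` to `b`; the beta function codes that sequence by one number `c`, removing the recursion. -/
theorem mem_prec_iff {f g : ℕ →. ℕ} {a n b : ℕ} :
    (b ∈ (n.rec (f a) fun y IH => IH >>= fun i => g (Nat.pair a (Nat.pair y i)) : Part ℕ)) ↔
      ∃ c, Nat.beta c 0 ∈ f a ∧ Nat.beta c n = b ∧
        ∀ y, y < n → Nat.beta c (y + 1) ∈ g (Nat.pair a (Nat.pair y (Nat.beta c y))) := by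
  constructor
  · intro hb
    have hseq : ∃ u : ℕ → ℕ, u 0 ∈ f a ∧ u n = b ∧
        ∀ y, y < n → u (y + 1) ∈ g (Nat.pair a (Nat.pair y (u y))) := by
      induction n generalizing b with
      | zero => exact ⟨fun _ => b, hb, rfl, fun y hy => absurd hy (Nat.not_lt_zero y)⟩
      | succ n ih =>
        obtain ⟨i, hi, hg⟩ := Part.mem_bind_iff.1 hb
        obtain ⟨u, h0, hn, hu⟩ := ih hi
        refine ⟨fun y => if y ≤ n then u y else b, by simpa using h0, by simp, fun y hy => ?_⟩
        have hyn : y ≤ n := by omega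
        rcases hyn.lt_or_eq with hlt | rfl
        · simpa [hyn, Nat.succ_le_of_lt hlt] using hu y hlt
        · simpa [hn] using hg
    obtain ⟨u, h0, hn, hu⟩ := hseq
    have hbeta : ∀ i, i ≤ n → Nat.beta (Nat.unbeta ((List.range (n + 1)).map u)) i = u i := by
      intro i hi
      have := Nat.beta_unbeta_coe ((List.range (n + 1)).map u)
        ⟨i, by simpa using Nat.lt_succ_of_le hi⟩
      simpa using! this
    refine ⟨Nat.unbeta ((List.range (n + 1)).map u), ?_, ?_, fun y hy => ?_⟩
    · rwa [hbeta 0 (Nat.zero_le n)]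
    · rw [hbeta n le_rfl, hn]
    · rw [hbeta y hy.le, hbeta (y + 1) hy]
      exact hu y hy
  · rintro ⟨c, h0, rfl, hu⟩
    induction n with
    | zero => exact h0
    | succ n ih =>
      exact Part.mem_bind_iff.2 ⟨_, ih fun y hy => hu y (hy.trans (Nat.lt_succ_self n)),
        hu n (Nat.lt_succ_self n)⟩

namespace Arithmetical

theorem of_partrec {F : ℕ →. ℕ} (hF : Nat.Partrec F) :
    ∀ {α : Type} {s t : (α → ℕ) → ℕ}, TermDefinable s → TermDefinable t →
      Arithmetical fun v => t v ∈ F (s v) := by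
  induction hF with
  | zero =>
    intro α s t _ ht
    exact (eq ht (.const 0)).of_iff fun v => Part.mem_some_iff
  | succ =>
    intro α s t hs ht
    exact (eq ht (hs.add (.const 1))).of_iff fun v => Part.mem_some_iff
  | left =>
    intro α s t hs ht
    refine of_iff (P := fun v => ∃ b, Nat.pair (t v) b = s v)
      (ex (pair ht.weaken .last hs.weaken)) fun v => Part.mem_some_iff.trans ?_
    constructor
    · intro h
      exact ⟨(s v).unpair.2, by rw [h, Nat.pair_unpair]⟩
    · rintro ⟨b, hb⟩
      simp [← hb]
  | right =>
    intro α s t hs ht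
    refine of_iff (P := fun v => ∃ a, Nat.pair a (t v) = s v)
      (ex (pair .last ht.weaken hs.weaken)) fun v => Part.mem_some_iff.trans ?_
    constructor
    · intro h
      exact ⟨(s v).unpair.1, by rw [h, Nat.pair_unpair]⟩
    · rintro ⟨b, hb⟩
      simp [← hb]
  | @pair f g _ _ hf hg =>
    intro α s t hs ht
    refine of_iff (P := fun v => ∃ a b, a ∈ f (s v) ∧ b ∈ g (s v) ∧ Nat.pair a b = t v)
      (ex (ex (and (hf hs.weaken.weaken (.var _)) (and (hg hs.weaken.weaken .last)
        (pair (.var _) .last ht.weaken.weaken))))) fun v => ?_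
    simp [Seq.seq, eq_comm]
  | @comp f g _ _ hf hg =>
    intro α s t hs ht
    exact of_iff (P := fun v => ∃ a, a ∈ g (s v) ∧ t v ∈ f a)
      (ex (and (hg hs.weaken .last) (hf .last ht.weaken))) fun v => Part.mem_bind_iff
  | @prec f g _ _ hf hg =>
    intro α s t hs ht
    -- Pairing and beta are available only as relations, so each intermediate value gets its own
    -- quantifier.
    refine of_iff (P := fun v => ∃ a n c x, Nat.pair a n = s v ∧ Nat.beta c 0 = x ∧ x ∈ f a ∧
      Nat.beta c n = t v ∧ ∀ y, y < n → ∃ i j p q, Nat.beta c y = i ∧ Nat.beta c (y + 1) = j ∧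
        Nat.pair y i = p ∧ Nat.pair a p = q ∧ j ∈ g q) ?_ fun v => ?_
    · refine ex (ex (ex (ex (and ?_ (and ?_ (and ?_ (and ?_ (all (imp ?_ (ex (ex (ex (ex
        (and ?_ (and ?_ (and ?_ (and ?_ ?_)))))))))))))))))
      · exact pair (.var _) (.var _) hs.weaken.weaken.weaken.weaken
      · exact beta (.var _) (.const 0) (.var _)
      · exact hf (.var _) (.var _)
      · exact beta (.var _) (.var _) ht.weaken.weaken.weaken.weaken
      · exact lt (.var _) (.var _)
      · exact beta (.var _) (.var _) (.var _)
      · exact beta (.var _) (.add (.var _) (.const 1)) (.var _)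
      · exact pair (.var _) (.var _) (.var _)
      · exact pair (.var _) (.var _) (.var _)
      · exact hg (.var _) (.var _)
    · refine mem_prec_iff.trans ?_
      constructor
      · rintro ⟨c, h0, hn, hu⟩
        exact ⟨_, _, c, _, Nat.pair_unpair (s v), rfl, h0, hn,
          fun y hy => ⟨_, _, _, _, rfl, rfl, rfl, rfl, hu y hy⟩⟩
      · rintro ⟨a, n, c, x, hs, rfl, h0, hn, hu⟩
        simp only [← hs, Nat.unpair_pair]
        refine ⟨c, h0, hn, fun y hy => ?_⟩
        obtain ⟨i, j, p, q, rfl, rfl, rfl, rfl, h⟩ := hu y hy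
        exact h
  | @rfind f _ hf =>
    intro α s t hs ht
    -- In `Nat.rfind` the value 0 means success; at smaller arguments `f` must be defined and
    -- nonzero.
    refine of_iff (P := fun v => (∃ p, Nat.pair (s v) (t v) = p ∧ 0 ∈ f p) ∧
      ∀ m, m < t v → ∃ q x, Nat.pair (s v) m = q ∧ ¬x = 0 ∧ x ∈ f q) ?_ fun v => ?_
    · refine and (ex (and ?_ ?_)) (all (imp ?_ (ex (ex (and ?_ (and (not ?_) ?_))))))
      · exact pair hs.weaken ht.weaken .last
      · exact hf .last (.const 0)
      · exact lt .last ht.weaken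
      · exact pair hs.weaken.weaken.weaken (.var _) (.var _)
      · exact eq .last (.const 0)
      · exact hf (.var _) .last
    · refine Nat.mem_rfind.trans (and_congr ?_ (forall_congr' fun m => forall_congr' fun _ => ?_))
      · simp
      · simp [and_comm]

end Arithmetical

/-! ### Reduction from the halting problem. -/

section Reduction

/-- The function whose domain is the halting problem. -/
def haltingFun (n : ℕ) : Part ℕ := Nat.Partrec.Code.eval (Denumerable.ofNat Nat.Partrec.Code n) 0

theorem partrec_haltingFun : Nat.Partrec haltingFun :=
  Partrec.nat_iff.1
    (Nat.Partrec.Code.eval_part.comp (Computable.ofNat _) (Computable.const 0))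

theorem not_computable_haltingFun_dom {h : ℕ → Bool} (hh : Computable h) :
    ¬∀ n, h n = true ↔ (haltingFun n).Dom := by
  intro H
  apply ComputablePred.halting_problem 0
  refine ComputablePred.computable_iff.2
    ⟨fun c => h (Encodable.encode c), hh.comp Computable.encode, funext fun c => propext ?_⟩
  simp [H, haltingFun]

theorem exists_formula_haltingFun_dom : ∃ φ : lang.Formula Unit, ∀ d, IsDivision d → ∀ n : ℕ,
    (@Formula.Realize lang ℝ (realStructure d) Unit φ fun _ => (n : ℝ)) ↔
      d = natDivision ∧ (haltingFun n).Dom := by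
  obtain ⟨φ, hφ⟩ : Arithmetical fun v : Unit → ℕ => ∃ b, b ∈ haltingFun (v ()) :=
    .ex (.of_partrec partrec_haltingFun (.var _) .last)
  refine ⟨natDivisionSentence Unit ⊓ φ, fun d hd n => ?_⟩
  rw [@Formula.realize_inf, realize_natDivisionSentence_iff hd, Part.dom_iff_mem]
  refine and_congr_right ?_
  rintro rfl
  exact hφ fun _ => n

/-- The formula `∀ x, x = n → ψ x`. -/
def instNum {α : Type} (ψ : lang.BoundedFormula α 1) (n : ℕ) : lang.Formula α :=
  BoundedFormula.all
    (BoundedFormula.imp (BoundedFormula.equal (Term.var (Sum.inr 0)) (numTerm n)) ψ)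

theorem realize_instNum {α : Type} (d : ℝ → ℝ → ℝ) (ψ : lang.BoundedFormula α 1) (n : ℕ)
    (v : α → ℝ) : @Formula.Realize lang ℝ (realStructure d) α (instNum ψ n) v ↔
      @BoundedFormula.Realize lang ℝ (realStructure d) α 1 ψ v (fun _ => (n : ℝ)) := by
  let := realStructure d
  have hsnoc : ∀ x : ℝ, (Fin.snoc (default : Fin 0 → ℝ) x : Fin 1 → ℝ) = fun _ => x := by
    intro x
    funext i
    fin_cases i
    rfl
  have : @Formula.Realize lang ℝ (realStructure d) α (instNum ψ n) v ↔
      ∀ x : ℝ, x = n → ψ.Realize v (Fin.snoc (default : Fin 0 → ℝ) x : Fin 1 → ℝ) := Iff.rfl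
  rw [this, forall_eq, hsnoc]

/-- Since `n` enters through the premise `x = n` and not by substitution, the code of `ψ` is a
constant and only one entry of a fixed nest of pairs varies. -/
theorem computable_formulaCode_instNum {α : Type} [Encodable α] (ψ : lang.BoundedFormula α 1) :
    Computable fun n => formulaCode (instNum ψ n) := by
  have hpair : ∀ {f g : ℕ → ℕ}, Primrec f → Primrec g → Primrec fun n => Nat.pair (f n) (g n) :=
    fun hf hg => Primrec₂.natPair.comp hf hg
  have hcode : ∀ n, formulaCode (instNum ψ n) = Nat.pair 4 (Nat.pair 3 (Nat.pair
      (Nat.pair 1 (Nat.pair (termCode (Term.var (Sum.inr 0 : α ⊕ Fin 1)))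
        (Nat.pair 1 (Nat.pair (Nat.pair 0 n) (Encodable.encode ([] : List ℕ))))))
      (formulaCode ψ))) := by
    intro n
    simp [instNum, formulaCode, numTerm, Constants.term, termCode, Func.code]
  refine Primrec.to_comp (Primrec.of_eq ?_ fun n => (hcode n).symm)
  have hc := fun m : ℕ => Primrec.const (α := ℕ) m
  exact hpair (hc 4) (hpair (hc 3) (hpair (hpair (hc 1) (hpair (hc _)
    (hpair (hc 1) (hpair (hpair (hc 0) Primrec.id) (hc _))))) (hc _)))

/-- The input becomes the bound variable that `instNum` fills, leaving `α` arbitrary, so that both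
formulas and sentences are covered. -/
theorem exists_boundedFormula_haltingFun_dom (α : Type) : ∃ ψ : lang.BoundedFormula α 1,
    ∀ d, IsDivision d → ∀ (n : ℕ) (v : α → ℝ),
      @BoundedFormula.Realize lang ℝ (realStructure d) α 1 ψ v (fun _ => (n : ℝ)) ↔
        d = natDivision ∧ (haltingFun n).Dom := by
  obtain ⟨φ, hφ⟩ := exists_formula_haltingFun_dom
  refine ⟨BoundedFormula.relabel (fun _ => Sum.inr (0 : Fin 1)) φ, fun d hd n v => ?_⟩
  let := realStructure d
  rw [← hφ d hd n]
  exact BoundedFormula.realize_relabel.trans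
    (Iff.of_eq (congrArg (BoundedFormula.Realize φ fun _ => (n : ℝ)) (Subsingleton.elim _ _)))

theorem not_algorithmicallyDecidable_satisfiable :
    ¬AlgorithmicallyDecidable (α := ℕ) Satisfiable := by
  rintro ⟨f, hf, H⟩
  obtain ⟨ψ, hψ⟩ := exists_boundedFormula_haltingFun_dom ℕ
  refine not_computable_haltingFun_dom (hf.comp (computable_formulaCode_instNum ψ)) fun n => ?_
  rw [H]
  constructor
  · rintro ⟨d, hd, v, hv⟩
    exact ((hψ d hd n v).1 ((realize_instNum d ψ n v).1 hv)).2
  · intro hn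
    exact ⟨natDivision, isDivision_natDivision, fun _ => 0, (realize_instNum _ ψ n _).2
      ((hψ _ isDivision_natDivision n _).2 ⟨rfl, hn⟩)⟩

theorem not_algorithmicallyDecidable_theory :
    ¬AlgorithmicallyDecidable (α := Empty) fun σ => σ ∈ theory := by
  rintro ⟨f, hf, H⟩
  obtain ⟨ψ, hψ⟩ := exists_boundedFormula_haltingFun_dom Empty
  refine not_computable_haltingFun_dom
    -- Validity of the negated formula expresses non-halting, hence the answer is flipped.
    (Primrec.not.to_comp.comp (hf.comp (computable_formulaCode_instNum ψ.not))) fun n => ?_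
  have hmem : instNum ψ.not n ∈ theory ↔ ¬(haltingFun n).Dom := by
    constructor
    · intro h hn
      refine (realize_instNum _ ψ.not n _).1 (h natDivision isDivision_natDivision) ?_
      exact (hψ _ isDivision_natDivision n _).2 ⟨rfl, hn⟩
    · intro hn d hd
      exact (realize_instNum d ψ.not n _).2 fun h => hn ((hψ d hd n _).1 h).2
  rw [← not_iff_not, ← hmem]
  simpa using H (instNum ψ.not n)

end Reduction

end NRA

/-- Real arithmetic with uninterpreted division by zero is undecidable: no algorithm decides
satisfiability of formulas, and no algorithm decides which sentences belong to the theory. -/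
theorem lemma2 :
    ¬ NRA.AlgorithmicallyDecidable (α := ℕ) NRA.Satisfiable ∧
      ¬ NRA.AlgorithmicallyDecidable (α := Empty) (fun σ => σ ∈ NRA.theory) :=
  ⟨NRA.not_algorithmicallyDecidable_satisfiable, NRA.not_algorithmicallyDecidable_theory⟩
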